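/- Let $n\ge 1$. A domain (nonempty connected open set) $D\subset\mathbb C^n$ is called $\mathbb C$-convex if every non-empty intersection of $D$ with a complex affine line is connected and simply connected. Let $D$ be a $\mathbb C$-convex domain containing no complex line, and let $z\in D$. Write $\mathbb D$ for the open unit disc in $\mathbb C$ and, for a vector $a$, put $d_D(z;a)=\sup\{r>0: z+r\mathbb D a\subset D\}$. Orthogonality is with respect to the standard Hermitian inner product. A maximal basis of $D$ at $z$ is an orthonormal basis $a_1,\dots,a_n$ of $\mathbb C^n$ with numbers $\mu_1,\dots,\mu_n>0$ such that $z+\mu_ja_j\in\partial D$ for all $j$, $\mu_1=\operatorname{dist}(z,\partial D)$, and for every $j\ge2$ $$\mu_j=d_D(z;a_j)=\sup\{d_D(z;a): a\perp a_1,\dots,a_{j-1},\ \|a\|=1\}.$$ Its numbers are reordered by $m_1(z)=\mu_1$ and $m_j(z)=\mu_{n+2-j}$ for $2\le j\le n$ (so that $m_1(z)\le\dots\le m_n(z)$). A minimal basis of $D$ at $z$ is an orthonormal basis $e_1,\dots,e_n$ of $\mathbb C^n$ with numbers $s_1(z)\le\dots\le s_n(z)$ such that, for every $j$, with $H=z+\operatorname{span}\{e_1,\dots,e_{j-1}\}^\perp$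 (so $H=\mathbb C^n$ if $j=1$), $s_j(z)=\operatorname{dist}(z,\partial_H(D\cap H))$ and $z+s_j(z)e_j\in\partial_H(D\cap H)$, where $\partial_H$ is the boundary relative to $H$. Then there is a constant $C>0$ depending only on $n$ such that for every such $D$, every $z\in D$, and every choice of a maximal basis and of a minimal basis of $D$ at $z$, $$m_j(z)\le C\,s_j(z)\quad\text{and}\quad s_j(z)\le C\,m_j(z),\qquad j=1,\dots,n.$$ -/

import Mathlib

open scoped ENNReal

noncomputable section

/-- `ℂⁿ` with its Hermitian inner product and Euclidean norm. -/
abbrev CSpace (n : ℕ) : Type := EuclideanSpace ℂ (Fin n)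

/-- The complex affine line through `p` in the direction `v` (a line when `v ≠ 0`). -/
def complexLine {n : ℕ} (p v : CSpace n) : Set (CSpace n) :=
  Set.range fun ζ : ℂ => p + ζ • v

/-- A `ℂ`-convex domain: a nonempty connected open set whose nonempty intersections with complex
lines are connected and simply connected (`SimplyConnectedSpace` includes path-connectedness). -/
structure IsCConvexDomain {n : ℕ} (D : Set (CSpace n)) : Prop where
  isOpen : IsOpen D
  isConnected : IsConnected D
  slice : ∀ p v : CSpace n, v ≠ 0 → (D ∩ complexLine p v).Nonempty →
    SimplyConnectedSpace ↥(D ∩ complexLine p v)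

/-- `D` contains no complex line. -/
def ContainsNoComplexLine {n : ℕ} (D : Set (CSpace n)) : Prop :=
  ∀ p v : CSpace n, v ≠ 0 → ¬ complexLine p v ⊆ D

/-- The boundary distance `d_D(q; a) = sup {r > 0 : q + r 𝔻 a ⊆ D}` of `q` in the direction `a`,
with values in `[0, ∞]`; `𝔻` is the open unit disc. -/
def dirDist {n : ℕ} (D : Set (CSpace n)) (q a : CSpace n) : ℝ≥0∞ :=
  ⨆ r ∈ {r : ℝ | 0 < r ∧ ∀ ζ : ℂ, ‖ζ‖ < 1 → q + ((r : ℂ) * ζ) • a ∈ D}, ENNReal.ofReal r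

/-- The orthogonal complement of the vectors `b i`, `i < j`. -/
def orthBefore {n : ℕ} (b : Fin n → CSpace n) (j : Fin n) : Submodule ℂ (CSpace n) :=
  (Submodule.span ℂ (b '' {i | i < j}))ᗮ

/-- The affine plane through `q` orthogonal to the vectors `b i`, `i < j`
(the whole space when `j` is the first index). -/
def planeBefore {n : ℕ} (q : CSpace n) (b : Fin n → CSpace n) (j : Fin n) : Set (CSpace n) :=
  {x | x - q ∈ orthBefore b j}

/-- The boundary of `D ∩ H` relative to `H`. -/
def relFrontier {n : ℕ} (H D : Set (CSpace n)) : Set (CSpace n) :=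
  (Subtype.val : H → CSpace n) '' frontier ((Subtype.val : H → CSpace n) ⁻¹' D)

/-- `a` is a maximal basis of `D` at `q`, in the order of its construction, with numbers `m`:
the first vector points to a nearest boundary point, and each later `a j` realizes the largest
directional boundary distance among the unit vectors orthogonal to the vectors before it. -/
structure IsMaximalBasis {n : ℕ} (D : Set (CSpace n)) (q : CSpace n)
    (a : OrthonormalBasis (Fin n) ℂ (CSpace n)) (m : Fin n → ℝ) : Prop where
  boundary_point : ∀ j, q + (m j : ℂ) • a j ∈ frontier D
  first : ∀ j : Fin n, (j : ℕ) = 0 → m j = Metric.infDist q (frontier D)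
  attained : ∀ j : Fin n, (j : ℕ) ≠ 0 → ENNReal.ofReal (m j) = dirDist D q (a j)
  maximal : ∀ j : Fin n, (j : ℕ) ≠ 0 →
    ENNReal.ofReal (m j) = ⨆ v ∈ {v : CSpace n | v ∈ orthBefore a j ∧ ‖v‖ = 1}, dirDist D q v

/-- `e` is a minimal basis of `D` at `q` with numbers `s`: at each step, `q + s j • e j` is a
boundary point of the slice of `D` by the plane through `q` orthogonal to the vectors before it
(relative to that plane) which is nearest to `q`. -/
structure IsMinimalBasis {n : ℕ} (D : Set (CSpace n)) (q : CSpace n)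
    (e : OrthonormalBasis (Fin n) ℂ (CSpace n)) (s : Fin n → ℝ) : Prop where
  boundary_point : ∀ j, q + (s j : ℂ) • e j ∈ relFrontier (planeBefore q e j) D
  nearest : ∀ j, s j = Metric.infDist q (relFrontier (planeBefore q e j) D)

/-- The reordering `1, n, n - 1, …, 2` of the indices `1, …, n`; here counted from `0`. -/
def reorder {n : ℕ} (j : Fin n) : Fin n :=
  ⟨if (j : ℕ) = 0 then 0 else n - j, by have := j.isLt; split_ifs <;> omega⟩

end

/-! At a point `q` of a `ℂ`-convex domain, the vectors spanning closed discs inside `D` form a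
convex set (`convex_discCore`). If a convex combination `p` of two disc points were missing, a
circle of complex lines through `p` would meet both discs. Their slices are simply connected and
avoid `p`, so the ratio of two sections would have a continuous logarithm; yet it winds once around
`0`.

The gauge `N` of this balanced convex set is thus a seminorm with `N v = 1 / d_D(q; v)`, positive
off `0` because `D` contains no complex line. A minimal basis maximizes `N` successively on unit
spheres. A maximal basis maximizes it once, then minimizes it successively.

What remains is linear algebra (`seminorm_reorder_comparable`). Coordinate subspaces of the two
bases whose dimensions total `n + 1` share a unit vector, and its seminorm links the two values. The
coordinate bounds come from `norm_inner_mul_le_seminorm`. -/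

/-! ### Continuous logarithms and winding -/

/-- A continuous function whose exponential is constant is constant. -/
theorem eq_of_exp_eq_const {X : Type*} [TopologicalSpace X] [PreconnectedSpace X] {f : X → ℂ}
    (hf : Continuous f) {c : ℂ} (h : ∀ x, Complex.exp (f x) = c) (x y : X) : f x = f y :=
  Complex.isCoveringMap_exp.const_of_comp hf (fun a b => Subtype.ext ((h a).trans (h b).symm)) x y

/-- There is no continuous branch of the logarithm of a nonzero multiple of the identity on the
unit circle. -/
theorem not_exists_log_circle (c : ℂ) (h : Circle → ℂ) (hh : Continuous h)
    (he : ∀ z : Circle, Complex.exp (h z) = c * z) : False := by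
  -- Lifted to `ℝ`, `h` minus `iθ` is constant, yet it changes by `-2πi` over one turn.
  have hc : Continuous fun θ : ℝ => h (Circle.exp θ) - θ * Complex.I := by fun_prop
  have key := eq_of_exp_eq_const (c := c) hc (fun θ => by
    rw [Complex.exp_sub, he, Circle.coe_exp, mul_div_assoc, div_self (Complex.exp_ne_zero _),
      mul_one]) 0 (2 * Real.pi)
  simp only [Circle.exp_zero, Circle.exp_two_pi, Complex.ofReal_zero, zero_mul, sub_zero] at key
  have : ((2 * Real.pi : ℝ) : ℂ) * Complex.I = 0 := by linear_combination key
  simp [Real.pi_ne_zero] at this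

/-- If the planar slices of an open set over a parameter space are simply connected and avoid `0`,
the quotient of two continuous sections has a continuous logarithm. -/
theorem exists_continuous_exp_eq_div {T : Type*} [TopologicalSpace T] {Ω : Set (T × ℂ)}
    (hΩ : IsOpen Ω) (hG : ∀ t, IsSimplyConnected {ζ | (t, ζ) ∈ Ω}) (h0 : ∀ t, (t, (0 : ℂ)) ∉ Ω)
    {A B : T → ℂ} (hA : Continuous A) (hB : Continuous B) (hAΩ : ∀ t, (t, A t) ∈ Ω)
    (hBΩ : ∀ t, (t, B t) ∈ Ω) :
    ∃ h : T → ℂ, Continuous h ∧ ∀ t, Complex.exp (h t) = A t / B t := by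
  have ex : ∀ t, ∃ L : ℂ → ℂ, ContinuousOn L {ζ | (t, ζ) ∈ Ω} ∧
      ∀ ζ, (t, ζ) ∈ Ω → Complex.exp (L ζ) = ζ := by
    intro t
    obtain ⟨f, hf, hfe⟩ := Complex.exists_continuousOn_eqOn_exp_comp (hG t)
      (hΩ.preimage (by fun_prop : Continuous fun ζ : ℂ => (t, ζ))) continuousOn_id
      (by simpa using h0 t)
    exact ⟨f, hf, fun ζ hζ => hfe hζ⟩
  choose L hLc hLe using ex
  have hne : ∀ t ζ, (t, ζ) ∈ Ω → ζ ≠ 0 := fun t ζ h hζ => h0 t (hζ ▸ h)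
  -- The branches `L t` are unrelated for different `t`, but this difference is independent of the
  -- branch because each slice is connected.
  refine ⟨fun t => L t (A t) - L t (B t), ?_, fun t => by
    rw [Complex.exp_sub, hLe t _ (hAΩ t), hLe t _ (hBΩ t)]⟩
  rw [continuous_iff_continuousAt]
  intro t₀
  obtain ⟨γ, hγ⟩ := (hG t₀).isPathConnected.joinedIn _ (hAΩ t₀) _ (hBΩ t₀)
  have hγ0 : ∀ s, γ s ≠ 0 := fun s => hne t₀ _ (hγ s)
  -- Deforms the path `γ` into one from `A t` to `B t`. For `t` near `t₀` it stays in the slice and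
  -- close enough to `γ` for the principal logarithm of the ratio to be continuous.
  let Γ : T × unitInterval → ℂ := fun x =>
    γ x.2 + ((1 - (x.2 : ℝ) : ℝ) : ℂ) * (A x.1 - A t₀) + ((x.2 : ℝ) : ℂ) * (B x.1 - B t₀)
  have hΓ : Continuous Γ := by fun_prop
  have hW : IsOpen {x : T × unitInterval | (x.1, Γ x) ∈ Ω ∧ ‖Γ x / γ x.2 - 1‖ < 1} := by
    have h1 : Continuous fun x : T × unitInterval => ‖Γ x / γ x.2 - 1‖ :=
      ((hΓ.div (by fun_prop) fun x => hγ0 _).sub continuous_const).norm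
    have h2 : Continuous fun x : T × unitInterval => (x.1, Γ x) := by fun_prop
    exact (hΩ.preimage h2).inter (isOpen_lt h1 continuous_const)
  obtain ⟨U, V, hU, -, htU, hV, hUV⟩ := generalized_tube_lemma
    (isCompact_singleton (x := t₀)) (isCompact_univ (X := unitInterval)) hW (by
      rintro ⟨t, s⟩ ⟨rfl, -⟩
      have : Γ (t, s) = γ s := by simp [Γ]
      simp only [Set.mem_ofPred_eq, this, div_self (hγ0 s), sub_self, norm_zero, zero_lt_one,
        and_true]
      exact hγ s)
  have htU : t₀ ∈ U := htU rfl
  have main : ∀ t ∈ U, L t (A t) - L t (B t) =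
      L t₀ (A t₀) - L t₀ (B t₀) + Complex.log (A t / A t₀) - Complex.log (B t / B t₀) := by
    intro t ht
    have hin : ∀ s, (t, Γ (t, s)) ∈ Ω ∧ ‖Γ (t, s) / γ s - 1‖ < 1 := fun s =>
      hUV (Set.mk_mem_prod ht (hV (Set.mem_univ s)))
    have hΓt : Continuous fun s => Γ (t, s) := by fun_prop
    have hslit : ∀ s, Γ (t, s) / γ s ∈ Complex.slitPlane := fun s => by
      simpa using Complex.mem_slitPlane_of_norm_lt_one (hin s).2
    have hδ : Continuous fun s => L t (Γ (t, s)) - L t₀ (γ s) - Complex.log (Γ (t, s) / γ s) := by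
      refine (Continuous.sub ?_ ?_).sub ?_
      · exact (hLc t).comp_continuous hΓt fun s => (hin s).1
      · exact (hLc t₀).comp_continuous γ.continuous hγ
      · exact (hΓt.div γ.continuous hγ0).clog hslit
    have := eq_of_exp_eq_const (c := 1) hδ (fun s => by
      have h1 := hne t _ (hin s).1
      have h2 := hγ0 s
      rw [Complex.exp_sub, Complex.exp_sub, hLe t _ (hin s).1, hLe t₀ _ (hγ s),
        Complex.exp_log (div_ne_zero h1 h2), div_self (div_ne_zero h1 h2)]) 0 1
    have e0 : Γ (t, 0) = A t := by simp [Γ]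
    have e1 : Γ (t, 1) = B t := by simp [Γ]
    simp only [e0, e1, γ.source, γ.target] at this
    linear_combination this
  have hcont : ContinuousAt (fun t => L t₀ (A t₀) - L t₀ (B t₀) + Complex.log (A t / A t₀) -
      Complex.log (B t / B t₀)) t₀ := by
    have a0 := hne t₀ _ (hAΩ t₀)
    have b0 := hne t₀ _ (hBΩ t₀)
    refine (continuousAt_const.add (ContinuousAt.clog ?_ ?_)).sub (ContinuousAt.clog ?_ ?_)
    · exact (hA.div_const _).continuousAt
    · rw [div_self a0]; exact Complex.one_mem_slitPlane
    · exact (hB.div_const _).continuousAt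
    · rw [div_self b0]; exact Complex.one_mem_slitPlane
  exact hcont.congr (Filter.eventually_of_mem (hU.mem_nhds htU) fun t ht => (main t ht).symm)

/-! ### Convex combinations of discs in a `ℂ`-convex domain -/

namespace IsCConvexDomain

variable {n : ℕ} {D : Set (CSpace n)}

theorem isSimplyConnected_slice (hD : IsCConvexDomain D) {p v : CSpace n} (hv : v ≠ 0)
    (hne : ∃ ζ : ℂ, p + ζ • v ∈ D) : IsSimplyConnected {ζ : ℂ | p + ζ • v ∈ D} := by
  have hemb : Topology.IsEmbedding fun ζ : ℂ => p + ζ • v :=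
    ((Homeomorph.addLeft p).isClosedEmbedding.comp
      (isClosedEmbedding_smul_left hv)).isEmbedding
  rw [← hemb.isSimplyConnected_image]
  have : (fun ζ : ℂ => p + ζ • v) '' {ζ : ℂ | p + ζ • v ∈ D} = D ∩ complexLine p v := by
    ext x
    simp only [complexLine, Set.mem_image, Set.mem_ofPred_eq, Set.mem_inter_iff, Set.mem_range]
    constructor
    · rintro ⟨ζ, h, rfl⟩; exact ⟨h, ζ, rfl⟩
    · rintro ⟨h, ζ, rfl⟩; exact ⟨ζ, h, rfl⟩
  rw [this]
  obtain ⟨ζ, h⟩ := hne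
  exact hD.slice p v hv ⟨_, h, ζ, rfl⟩

/-- A `ℂ`-convex domain containing two closed discs centred at `q` contains every convex
combination of their boundary points. -/
theorem add_mem_of_discs (hD : IsCConvexDomain D) {q u w : CSpace n} {α β : ℝ} (hα : 0 < α)
    (hβ : 0 < β) (hαβ : α + β = 1) (hu : ∀ ζ : ℂ, ‖ζ‖ ≤ 1 → q + ζ • u ∈ D)
    (hw : ∀ ζ : ℂ, ‖ζ‖ ≤ 1 → q + ζ • w ∈ D) : q + ((α : ℂ) • u + (β : ℂ) • w) ∈ D := by
  by_contra hp
  set p := q + ((α : ℂ) • u + (β : ℂ) • w) with hpdef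
  have hα0 : (α : ℂ) ≠ 0 := by exact_mod_cast hα.ne'
  have hβ0 : (β : ℂ) ≠ 0 := by exact_mod_cast hβ.ne'
  -- The line through `p` in direction `v τ` meets the disc of `u` at parameter `1` and the disc of
  -- `w` at parameter `B τ`.
  let v : Circle → CSpace n := fun τ => ((β : ℂ) * τ) • u - (β : ℂ) • w
  let B : Circle → ℂ := fun τ => -((α : ℂ) / β * (τ : ℂ)⁻¹)
  have hv1 : ∀ τ : Circle, p + (1 : ℂ) • v τ ∈ D := by
    intro τ
    have : p + (1 : ℂ) • v τ = q + ((α : ℂ) + β * τ) • u := by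
      simp only [hpdef, v]; module
    rw [this]
    refine hu _ ((norm_add_le _ _).trans ?_)
    simp [abs_of_pos hα, abs_of_pos hβ, Circle.norm_coe, hαβ]
  have hvB : ∀ τ : Circle, p + B τ • v τ ∈ D := by
    intro τ
    have hτ : (τ : ℂ) ≠ 0 := τ.coe_ne_zero
    have : p + B τ • v τ = q + ((β : ℂ) + α * (τ : ℂ)⁻¹) • w := by
      simp only [hpdef, v, B, smul_sub, smul_smul]
      have e1 : -((α : ℂ) / β * (τ : ℂ)⁻¹) * (β * τ) = -α := by field_simp
      have e2 : -((α : ℂ) / β * (τ : ℂ)⁻¹) * β = -(α * (τ : ℂ)⁻¹) := by field_simp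
      rw [e1, e2]; module
    rw [this]
    refine hw _ ((norm_add_le _ _).trans ?_)
    simp [abs_of_pos hα, abs_of_pos hβ, Circle.norm_coe, add_comm β α, hαβ]
  have hv0 : ∀ τ, v τ ≠ 0 := fun τ h => hp (by simpa [h] using hv1 τ)
  have hvc : Continuous v := by fun_prop
  have hBc : Continuous B :=
    (continuous_const.mul (Continuous.inv₀ (by fun_prop) fun τ : Circle => τ.coe_ne_zero)).neg
  clear_value v
  have hΩ : IsOpen {x : Circle × ℂ | p + x.2 • v x.1 ∈ D} :=
    hD.isOpen.preimage (f := fun x : Circle × ℂ => p + x.2 • v x.1) (by fun_prop)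
  obtain ⟨h, hh, he⟩ := exists_continuous_exp_eq_div hΩ
    (fun τ => hD.isSimplyConnected_slice (hv0 τ) ⟨1, hv1 τ⟩)
    (fun τ => show ¬ p + (0 : ℂ) • v τ ∈ D by simpa using hp)
    (continuous_const (y := (1 : ℂ))) hBc hv1 hvB
  -- The ratio `1 / B τ` equals `-(β/α) τ`, which has winding number one.
  refine not_exists_log_circle (-((β : ℂ) / α)) h hh fun τ => ?_
  have hτ : (τ : ℂ) ≠ 0 := τ.coe_ne_zero
  rw [he]; simp only [B]; field_simp

end IsCConvexDomain

/-! ### Seminorms and orthonormal bases -/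

/-- If a seminorm on a subspace is maximal on the unit sphere at `e`, then it dominates the
coefficient along `e`. -/
theorem norm_inner_mul_le_seminorm {E : Type*} [NormedAddCommGroup E] [InnerProductSpace ℂ E]
    (N : Seminorm ℂ E) {H : Submodule ℂ E} {e : E} (he : e ∈ H) (hn : ‖e‖ = 1)
    (hmax : ∀ v ∈ H, N v ≤ N e * ‖v‖) {v : E} (hv : v ∈ H) : ‖inner ℂ e v‖ * N e ≤ N v := by
  -- First-order variation: rescale `v` to `w` with `⟨e, w⟩ = 1` and `N w < N e`. Then `e - ε w` has
  -- norm `1 - ε + O(ε²)`, while its seminorm is at least `N e - ε N w`, violating maximality for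
  -- small `ε`.
  by_contra! hlt
  set c : ℂ := inner ℂ e v with hc
  have hσ : 0 < N e := (apply_nonneg N e).lt_of_ne fun h => by
    rw [← h, mul_zero] at hlt
    exact hlt.not_ge (apply_nonneg N v)
  have hc0 : c ≠ 0 := fun h => by
    rw [h, norm_zero, zero_mul] at hlt
    exact hlt.not_ge (apply_nonneg N v)
  set w := c⁻¹ • v with hw
  have hew : inner ℂ e w = 1 := by rw [hw, inner_smul_right, ← hc, inv_mul_cancel₀ hc0]
  have hwH : w ∈ H := H.smul_mem _ hv
  have hNw : N w < N e := by
    rw [hw, map_smul_eq_mul, norm_inv, inv_mul_lt_iff₀ (norm_pos_iff.2 hc0)]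
    exact hlt
  obtain ⟨x, hx⟩ : ∃ x, N w = x * N e := ⟨N w / N e, by field_simp⟩
  have hx0 : 0 ≤ x := by
    have := apply_nonneg N w
    rw [hx] at this
    exact nonneg_of_mul_nonneg_left this hσ
  have hx1 : x < 1 := by
    rw [hx] at hNw
    by_contra! h
    nlinarith
  have hV : 0 < 1 + ‖w‖ ^ 2 := by positivity
  -- Comparing squares will give `2(1 - x) ≤ ε‖w‖²`, which this `ε` contradicts; `ε ≤ 1` keeps `1 -
  -- εx` nonnegative.
  obtain ⟨ε, hε⟩ : ∃ ε, ε * (1 + ‖w‖ ^ 2) = 1 - x := ⟨(1 - x) / (1 + ‖w‖ ^ 2), by field_simp⟩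
  have hε0 : 0 < ε := by
    by_contra! h
    nlinarith
  have hε1 : ε ≤ 1 := by nlinarith [mul_nonneg hε0.le (sq_nonneg ‖w‖)]
  have hsq : ‖e - (ε : ℂ) • w‖ ^ 2 = 1 - 2 * ε + ε ^ 2 * ‖w‖ ^ 2 := by
    rw [norm_sub_sq (𝕜 := ℂ), inner_smul_right, hew, hn, norm_smul, mul_pow]
    simp
  have htri : N e ≤ ε * (x * N e) + N e * ‖e - (ε : ℂ) • w‖ := by
    calc N e = N ((ε : ℂ) • w + (e - (ε : ℂ) • w)) := by congr 1; abel
      _ ≤ N ((ε : ℂ) • w) + N (e - (ε : ℂ) • w) := map_add_le_add N _ _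
      _ ≤ _ := by
        gcongr
        · rw [map_smul_eq_mul, hx, Complex.norm_real, Real.norm_of_nonneg hε0.le]
        · exact hmax _ (H.sub_mem he (H.smul_mem _ hwH))
  have h1 : 1 - ε * x ≤ ‖e - (ε : ℂ) • w‖ := by
    refine le_of_mul_le_mul_left ?_ hσ
    linarith
  have h2 : (1 - ε * x) ^ 2 ≤ 1 - 2 * ε + ε ^ 2 * ‖w‖ ^ 2 := by
    rw [← hsq]
    exact pow_le_pow_left₀ (by nlinarith) h1 2
  have h3 : ε * (2 * (1 - x)) ≤ ε * (ε * ‖w‖ ^ 2) := by nlinarith [sq_nonneg (ε * x)]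
  have h4 := le_of_mul_le_mul_left h3 hε0
  nlinarith

theorem mem_orthBefore {n : ℕ} {b : Fin n → CSpace n} {j : Fin n} {v : CSpace n} :
    v ∈ orthBefore b j ↔ ∀ i < j, inner ℂ (b i) v = 0 := by
  rw [orthBefore, Submodule.mem_orthogonal]
  constructor
  · exact fun h i hi => h _ (Submodule.subset_span ⟨i, hi, rfl⟩)
  · intro h u hu
    induction hu using Submodule.span_induction with
    | mem x hx => obtain ⟨i, hi, rfl⟩ := hx; exact h i hi
    | zero => exact inner_zero_left _
    | add x y _ _ hx hy => rw [inner_add_left, hx, hy, add_zero]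
    | smul c x _ hx => rw [inner_smul_left, hx, mul_zero]

theorem OrthonormalBasis.inner_apply_of_ne {n : ℕ} (b : OrthonormalBasis (Fin n) ℂ (CSpace n))
    {i j : Fin n} (h : i ≠ j) : inner ℂ (b i) (b j) = 0 := b.orthonormal.2 h

theorem OrthonormalBasis.inner_self_apply {n : ℕ} (b : OrthonormalBasis (Fin n) ℂ (CSpace n))
    (i : Fin n) : inner ℂ (b i) (b i) = 1 := by
  rw [inner_self_eq_norm_sq_to_K, b.orthonormal.1]; simp

theorem OrthonormalBasis.mem_orthBefore_of_le {n : ℕ}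
    (b : OrthonormalBasis (Fin n) ℂ (CSpace n)) {i j : Fin n} (h : i ≤ j) :
    b j ∈ orthBefore b i :=
  mem_orthBefore.2 fun _ hk => b.inner_apply_of_ne (hk.trans_le h).ne

/-- Two coordinate subspaces, relative to two orthonormal bases, whose dimensions add up to more
than `n` have a common unit vector. -/
theorem exists_unit_vector_inner_eq_zero {n : ℕ} (a e : OrthonormalBasis (Fin n) ℂ (CSpace n))
    (I J : Finset (Fin n)) (h : n < I.card + J.card) :
    ∃ v : CSpace n, ‖v‖ = 1 ∧ (∀ i ∉ I, inner ℂ (a i) v = 0) ∧ ∀ i ∉ J, inner ℂ (e i) v = 0 := by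
  let f : CSpace n →ₗ[ℂ] ({i // i ∉ I} → ℂ) × ({i // i ∉ J} → ℂ) :=
    (LinearMap.pi fun i => (innerSL ℂ (a i.1)).toLinearMap).prod
      (LinearMap.pi fun i => (innerSL ℂ (e i.1)).toLinearMap)
  have hI := I.card_le_univ
  have hJ := J.card_le_univ
  rw [Fintype.card_fin] at hI hJ
  have hlt : Module.finrank ℂ (({i // i ∉ I} → ℂ) × ({i // i ∉ J} → ℂ)) <
      Module.finrank ℂ (CSpace n) := by
    rw [Module.finrank_prod, Module.finrank_fintype_fun_eq_card,
      Module.finrank_fintype_fun_eq_card, finrank_euclideanSpace_fin,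
      Fintype.card_subtype_compl, Fintype.card_subtype_compl, Fintype.card_coe, Fintype.card_coe,
      Fintype.card_fin]
    omega
  obtain ⟨w, hw, hw0⟩ := Submodule.exists_mem_ne_zero_of_ne_bot
    (LinearMap.ker_ne_bot_of_finrank_lt (f := f) hlt)
  have hfw : f w = 0 := hw
  have h1 : ∀ i ∉ I, inner ℂ (a i) w = 0 := fun i hi => congrFun (congrArg Prod.fst hfw) ⟨i, hi⟩
  have h2 : ∀ i ∉ J, inner ℂ (e i) w = 0 := fun i hi => congrFun (congrArg Prod.snd hfw) ⟨i, hi⟩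
  refine ⟨((‖w‖⁻¹ : ℝ) : ℂ) • w, ?_, fun i hi => ?_, fun i hi => ?_⟩
  · rw [norm_smul, Complex.norm_real, norm_inv, norm_norm,
      inv_mul_cancel₀ (norm_ne_zero_iff.2 hw0)]
  · rw [inner_smul_right, h1 i hi, mul_zero]
  · rw [inner_smul_right, h2 i hi, mul_zero]

section Comparison

variable {n : ℕ} (N : Seminorm ℂ (CSpace n)) (a e : OrthonormalBasis (Fin n) ℂ (CSpace n))

theorem seminorm_le_sum (v : CSpace n) : N v ≤ ∑ i, ‖inner ℂ (a i) v‖ * N (a i) := by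
  conv_lhs => rw [← a.sum_repr' v]
  refine (Finset.le_sum_of_subadditive N (map_zero N).le (map_add_le_add N) _ _).trans (Finset.sum_le_sum fun i _ => ?_)
  rw [map_smul_eq_mul]

/-- Subtracting the earlier components puts `v` in `orthBefore e i`, where maximality applies. By
induction this costs the factor `1 + ∑_{k<i} 2^k = 2^i`. -/
theorem norm_inner_mul_le_two_pow (he : ∀ j, ∀ v ∈ orthBefore e j, N v ≤ N (e j) * ‖v‖)
    (i : Fin n) (v : CSpace n) : ‖inner ℂ (e i) v‖ * N (e i) ≤ 2 ^ (i : ℕ) * N v := by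
  induction i using WellFoundedLT.induction with
  | ind i ih =>
  set w := v - ∑ k ∈ Finset.Iio i, inner ℂ (e k) v • e k with hw
  have hinner : ∀ l, inner ℂ (e l) w =
      inner ℂ (e l) v - if l < i then inner ℂ (e l) v else 0 := by
    intro l
    rw [hw, inner_sub_right, inner_sum]
    congr 1
    simp only [inner_smul_right, orthonormal_iff_ite.1 e.orthonormal, mul_ite, mul_one, mul_zero,
      Finset.sum_ite_eq, Finset.mem_Iio]
  have hmem : w ∈ orthBefore e i := mem_orthBefore.2 fun l hl => by rw [hinner, if_pos hl, sub_self]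
  have h1 := norm_inner_mul_le_seminorm N (e.mem_orthBefore_of_le le_rfl) (e.orthonormal.1 i)
    (he i) hmem
  rw [hinner, if_neg (lt_irrefl i), sub_zero] at h1
  refine h1.trans ?_
  have h2 : N (∑ k ∈ Finset.Iio i, inner ℂ (e k) v • e k) ≤
      ∑ k ∈ Finset.Iio i, 2 ^ (k : ℕ) * N v := by
    refine (Finset.le_sum_of_subadditive N (map_zero N).le (map_add_le_add N) _ _).trans (Finset.sum_le_sum fun k hk => ?_)
    rw [map_smul_eq_mul]
    exact ih k (Finset.mem_Iio.1 hk)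
  have h3 : ∑ k ∈ Finset.Iio i, (2 : ℝ) ^ (k : ℕ) = 2 ^ (i : ℕ) - 1 := by
    have := Finset.sum_map (Finset.Iio i) Fin.valEmbedding fun k => (2 : ℝ) ^ k
    rw [Fin.map_valEmbedding_Iio, Nat.Iio_eq_range, geom_sum_eq (by norm_num)] at this
    simp only [Fin.valEmbedding_apply] at this
    rw [← this]; ring
  rw [← Finset.sum_mul, h3] at h2
  have := map_sub_le_add N v (∑ k ∈ Finset.Iio i, inner ℂ (e k) v • e k)
  rw [← hw] at this
  linarith

/-- The values of a seminorm on a basis obtained by successive maximization and on a basis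
obtained by one maximization followed by successive minimizations agree up to a constant. -/
theorem seminorm_reorder_comparable
    (he : ∀ j, ∀ v ∈ orthBefore e j, N v ≤ N (e j) * ‖v‖)
    (ha0 : ∀ j : Fin n, (j : ℕ) = 0 → ∀ v, N v ≤ N (a j) * ‖v‖)
    (ha : ∀ j : Fin n, (j : ℕ) ≠ 0 → ∀ v ∈ orthBefore a j, N (a j) * ‖v‖ ≤ N v) (j : Fin n) :
    N (a (reorder j)) ≤ 3 * N (e j) ∧ N (e j) ≤ n ^ 2 * 2 ^ n * N (a (reorder j)) := by
  have hN := fun v => apply_nonneg N v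
  have hn : (1 : ℝ) ≤ n := by exact_mod_cast j.pos
  by_cases hj : (j : ℕ) = 0
  · have hr : reorder j = j := Fin.ext (by simp [reorder, hj])
    rw [hr]
    have h1 := he j (a j) (mem_orthBefore.2 fun i hi => by have : (i : ℕ) < j := hi; omega)
    have h2 := ha0 j hj (e j)
    rw [a.orthonormal.1, mul_one] at h1
    rw [e.orthonormal.1, mul_one] at h2
    have h3 : (1 : ℝ) ≤ n ^ 2 * 2 ^ n :=
      one_le_mul_of_one_le_of_one_le (one_le_pow₀ hn) (one_le_pow₀ one_le_two)
    exact ⟨by linarith [hN (e j)], h2.trans (le_mul_of_one_le_left (hN _) h3)⟩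
  have hk : ((reorder j : Fin n) : ℕ) = n - j := by simp [reorder, hj]
  set k := reorder j
  have hjn := j.isLt
  have hk0 : (k : ℕ) ≠ 0 := by omega
  let z : Fin n := ⟨0, j.pos⟩
  have hz : (z : ℕ) = 0 := rfl
  have hzk : z < k := Fin.lt_def.2 (by omega)
  constructor
  -- The dimensions are `1 + j` and `n - j`. The vector `a z` is needed for the count, but
  -- minimality of `a k` only concerns vectors orthogonal to it, so that component is removed below.
  · obtain ⟨v, hv1, hva, hve⟩ := exists_unit_vector_inner_eq_zero a e
      (insert z (Finset.Ici k)) (Finset.Ici j) (by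
        rw [Finset.card_insert_of_notMem (by simpa using hzk), Fin.card_Ici, Fin.card_Ici]
        omega)
    have hNv : N v ≤ N (e j) := by
      have := he j v (mem_orthBefore.2 fun i hi => hve i (by simpa using hi))
      rwa [hv1, mul_one] at this
    set c : ℂ := inner ℂ (a z) v with hc
    have hcz : ‖c‖ * N (a z) ≤ N v := norm_inner_mul_le_seminorm N (H := ⊤) Submodule.mem_top
      (a.orthonormal.1 z) (fun v _ => ha0 z hz v) Submodule.mem_top
    have hx := ha k hk0 (v - c • a z) (mem_orthBefore.2 fun i hi => by
      rw [inner_sub_right, inner_smul_right]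
      by_cases hiz : i = z
      · rw [hiz, a.inner_self_apply, mul_one, hc, sub_self]
      · rw [a.inner_apply_of_ne hiz, hva i (by simp [hiz, hi]), mul_zero, sub_self])
    have hx2 : N (v - c • a z) ≤ N v + ‖c‖ * N (a z) := by
      rw [← map_smul_eq_mul]; exact map_sub_le_add N _ _
    have h1 : 1 ≤ ‖v - c • a z‖ + ‖c‖ := by
      have := norm_add_le (v - c • a z) (c • a z)
      rwa [sub_add_cancel, hv1, norm_smul, a.orthonormal.1, mul_one] at this
    have h2 : N (a k) ≤ N (a z) := by simpa [a.orthonormal.1] using ha0 z hz (a k)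
    -- The factor `3`: `N (a k) * ‖v - c • a z‖ ≤ 2 * N v` and `N (a k) * ‖c‖ ≤ N v`, while the two
    -- norms add up to at least `1`.
    nlinarith [hN (a k), norm_nonneg c, mul_le_mul_of_nonneg_left h2 (norm_nonneg c),
      mul_le_mul_of_nonneg_left h1 (hN (a k))]
  -- The dimensions are `n - j` and `j + 1`. On the first span `N` is controlled by `N (a k)`, its
  -- largest basis value; on the second, `N (e j)` is the smallest basis value.
  · obtain ⟨v, hv1, hva, hve⟩ := exists_unit_vector_inner_eq_zero a e
      (Finset.Ioc z k) (Finset.Iic j) (by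
        rw [Fin.card_Ioc, Fin.card_Iic]
        omega)
    have h1 : N v ≤ n * N (a k) := by
      refine (seminorm_le_sum N a v).trans ?_
      have : ∀ i ∈ Finset.univ, ‖inner ℂ (a i) v‖ * N (a i) ≤ N (a k) := by
        intro i _
        by_cases hi : i ∈ Finset.Ioc z k
        · rw [Finset.mem_Ioc] at hi
          have hle := ha i (by have : (z : ℕ) < i := hi.1; omega) _ (a.mem_orthBefore_of_le hi.2)
          rw [a.orthonormal.1, mul_one] at hle
          have hin := norm_inner_le_norm (𝕜 := ℂ) (a i) v
          rw [a.orthonormal.1, hv1, mul_one] at hin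
          exact (mul_le_of_le_one_left (hN _) hin).trans hle
        · rw [hva i hi, norm_zero, zero_mul]; exact hN _
      simpa using Finset.sum_le_card_nsmul _ _ _ this
    have h2 : N (e j) ≤ n * (2 ^ n * N v) := by
      have hsum : ‖v‖ ≤ ∑ i, ‖inner ℂ (e i) v‖ := by
        conv_lhs => rw [← e.sum_repr' v]
        refine (norm_sum_le _ _).trans (Finset.sum_le_sum fun i _ => ?_)
        rw [norm_smul, e.orthonormal.1, mul_one]
      have : ∀ i ∈ Finset.univ, ‖inner ℂ (e i) v‖ * N (e j) ≤ 2 ^ n * N v := by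
        intro i _
        by_cases hi : i ≤ j
        · have hle := he i _ (e.mem_orthBefore_of_le hi)
          rw [e.orthonormal.1, mul_one] at hle
          refine (mul_le_mul_of_nonneg_left hle (norm_nonneg _)).trans
            ((norm_inner_mul_le_two_pow N e he i v).trans ?_)
          exact mul_le_mul_of_nonneg_right (pow_le_pow_right₀ one_le_two i.isLt.le) (hN v)
        · rw [hve i (by simpa using hi), norm_zero, zero_mul]
          exact mul_nonneg (by positivity) (hN v)
      have h3 := Finset.sum_le_card_nsmul _ _ _ this
      rw [← Finset.sum_mul] at h3
      rw [hv1] at hsum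
      have h4 := le_mul_of_one_le_left (hN (e j)) hsum
      simpa using h4.trans h3
    calc N (e j) ≤ n * (2 ^ n * N v) := h2
      _ ≤ n * (2 ^ n * (n * N (a k))) := by gcongr
      _ = _ := by ring

end Comparison

/-! ### The reciprocal boundary distance as a seminorm -/

/-- The vectors `v` such that `D` contains the closed disc centred at `q` with radius vector
`v`. -/
def discCore {n : ℕ} (D : Set (CSpace n)) (q : CSpace n) : Set (CSpace n) :=
  {v | ∀ ζ : ℂ, ‖ζ‖ ≤ 1 → q + ζ • v ∈ D}

theorem balanced_discCore {n : ℕ} (D : Set (CSpace n)) (q : CSpace n) :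
    Balanced ℂ (discCore D q) := by
  rw [balanced_iff_smul_mem]
  intro c hc v hv ζ hζ
  rw [smul_smul]
  exact hv _ (by rw [norm_mul]; exact mul_le_one₀ hζ (norm_nonneg _) hc)

theorem absorbent_discCore {n : ℕ} {D : Set (CSpace n)} (hD : IsOpen D) {q : CSpace n}
    (hq : q ∈ D) : Absorbent ℝ (discCore D q) := by
  obtain ⟨r, hr, hball⟩ := Metric.isOpen_iff.1 hD q hq
  refine absorbent_nhds_zero (Filter.mem_of_superset (Metric.ball_mem_nhds 0 hr) ?_)
  intro v hv ζ hζ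
  apply hball
  rw [mem_ball_zero_iff] at hv
  rw [mem_ball_iff_norm, add_sub_cancel_left, norm_smul]
  exact (mul_le_of_le_one_left (norm_nonneg _) hζ).trans_lt hv

namespace IsCConvexDomain

variable {n : ℕ} {D : Set (CSpace n)}

theorem convex_discCore (hD : IsCConvexDomain D) (q : CSpace n) : Convex ℝ (discCore D q) := by
  rw [convex_iff_forall_pos]
  intro u hu w hw α β hα hβ hαβ ζ hζ
  have aux : ∀ v ∈ discCore D q, ∀ ξ : ℂ, ‖ξ‖ ≤ 1 → q + ξ • ζ • v ∈ D := by
    intro v hv ξ hξ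
    rw [smul_smul]
    exact hv _ (by rw [norm_mul]; exact mul_le_one₀ hξ (norm_nonneg _) hζ)
  have := hD.add_mem_of_discs hα hβ hαβ (aux u hu) (aux w hw)
  rwa [smul_comm _ ζ u, smul_comm _ ζ w, ← smul_add, Complex.coe_smul, Complex.coe_smul] at this

/-- The reciprocal of the directional boundary distance at a point of a `ℂ`-convex domain, as a
seminorm. -/
noncomputable def discSeminorm (hD : IsCConvexDomain D) {q : CSpace n} (hq : q ∈ D) : Seminorm ℂ (CSpace n) :=
  gaugeSeminorm (balanced_discCore D q) (hD.convex_discCore q) (absorbent_discCore hD.isOpen hq)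

variable (hD : IsCConvexDomain D) {q : CSpace n} (hq : q ∈ D)

theorem discSeminorm_le_one {v : CSpace n} (hv : v ∈ discCore D q) :
    hD.discSeminorm hq v ≤ 1 :=
  gauge_le_one_of_mem hv

theorem add_mem_of_discSeminorm_lt_one {v : CSpace n} (hv : hD.discSeminorm hq v < 1) :
    q + v ∈ D := by
  have h : v ∈ discCore D q := setOfPred_gauge_lt_one_subset_self (hD.convex_discCore q)
    (absorbent_discCore hD.isOpen hq).zero_mem (absorbent_discCore hD.isOpen hq) hv
  simpa using h 1 (by simp)

theorem mul_discSeminorm_le_one {v : CSpace n} {r : ℝ}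
    (h : ∀ ζ : ℂ, ‖ζ‖ < r → q + ζ • v ∈ D) : r * hD.discSeminorm hq v ≤ 1 := by
  by_contra! hlt
  have hN := apply_nonneg (hD.discSeminorm hq) v
  have hN0 : 0 < hD.discSeminorm hq v := hN.lt_of_ne fun h0 => by
    rw [← h0, mul_zero] at hlt
    exact absurd hlt (by norm_num)
  -- A radius strictly below `r` turns the open disc into a closed one, as `discCore` requires.
  obtain ⟨t, ht1, ht2⟩ := exists_between ((div_lt_iff₀ hN0).2 hlt)
  have ht0 : 0 < t := (by positivity : 0 < 1 / hD.discSeminorm hq v).trans ht1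
  have : hD.discSeminorm hq ((t : ℂ) • v) ≤ 1 := hD.discSeminorm_le_one hq fun ζ hζ => by
    rw [smul_smul]
    refine h _ ?_
    rw [norm_mul, Complex.norm_real, Real.norm_of_nonneg ht0.le]
    exact (mul_le_of_le_one_left ht0.le hζ).trans_lt ht2
  rw [map_smul_eq_mul, Complex.norm_real, Real.norm_of_nonneg ht0.le] at this
  exact ((div_lt_iff₀ hN0).1 ht1).not_ge this

theorem one_le_mul_discSeminorm {v : CSpace n} {r : ℝ} (hr : 0 ≤ r)
    (h : q + (r : ℂ) • v ∉ D) : 1 ≤ r * hD.discSeminorm hq v := by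
  by_contra! hlt
  refine h (hD.add_mem_of_discSeminorm_lt_one hq ?_)
  rwa [map_smul_eq_mul, Complex.norm_real, Real.norm_of_nonneg hr]

theorem discSeminorm_pos (hline : ContainsNoComplexLine D) {v : CSpace n} (hv : v ≠ 0) :
    0 < hD.discSeminorm hq v := by
  refine (apply_nonneg _ v).lt_of_ne fun h0 => hline q v hv ?_
  rintro _ ⟨ζ, rfl⟩
  refine hD.add_mem_of_discSeminorm_lt_one hq ?_
  rw [map_smul_eq_mul, ← h0, mul_zero]
  exact zero_lt_one

theorem dirDist_eq (hline : ContainsNoComplexLine D) {v : CSpace n} (hv : v ≠ 0) :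
    dirDist D q v = ENNReal.ofReal (hD.discSeminorm hq v)⁻¹ := by
  have hN := hD.discSeminorm_pos hq hline hv
  apply le_antisymm
  · refine iSup₂_le fun r hr => ENNReal.ofReal_le_ofReal ?_
    rw [← one_div, le_div_iff₀ hN]
    refine hD.mul_discSeminorm_le_one hq fun ζ hζ => ?_
    have hr0 : (r : ℂ) ≠ 0 := by exact_mod_cast hr.1.ne'
    have := hr.2 (ζ / r) (by
      rwa [norm_div, Complex.norm_real, Real.norm_of_nonneg hr.1.le, div_lt_one hr.1])
    rwa [mul_div_cancel₀ _ hr0] at this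
  · refine le_iSup₂_of_le (hD.discSeminorm hq v)⁻¹ ⟨inv_pos.2 hN, fun ζ hζ => ?_⟩ le_rfl
    refine hD.add_mem_of_discSeminorm_lt_one hq ?_
    rwa [map_smul_eq_mul, norm_mul, Complex.norm_real, Real.norm_of_nonneg (inv_pos.2 hN).le,
      mul_right_comm, inv_mul_cancel₀ hN.ne', one_mul]

/-- A boundary direction of a round ball in a subspace maximizes the seminorm there. -/
theorem discSeminorm_of_sphere {H : Submodule ℂ (CSpace n)} {r : ℝ} (hr : 0 < r) {e : CSpace n}
    (he : e ∈ H) (hn : ‖e‖ = 1) (hball : ∀ v ∈ H, ‖v‖ < r → q + v ∈ D)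
    (hout : q + (r : ℂ) • e ∉ D) :
    hD.discSeminorm hq e = r⁻¹ ∧
      ∀ v ∈ H, hD.discSeminorm hq v ≤ hD.discSeminorm hq e * ‖v‖ := by
  have h1 := hD.one_le_mul_discSeminorm hq hr.le hout
  have h2 : ∀ v ∈ H, r * hD.discSeminorm hq v ≤ ‖v‖ := by
    intro v hv
    rcases eq_or_ne v 0 with rfl | hv0
    · simp
    have hv' := norm_pos_iff.2 hv0
    have := hD.mul_discSeminorm_le_one hq (v := v) (r := r / ‖v‖) fun ζ hζ => by
      refine hball _ (H.smul_mem _ hv) ?_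
      rwa [norm_smul, ← lt_div_iff₀ hv']
    rwa [div_mul_eq_mul_div, div_le_one hv'] at this
  have h3 : hD.discSeminorm hq e = r⁻¹ := by
    have := h2 e he
    rw [hn] at this
    exact eq_inv_of_mul_eq_one_right (le_antisymm this h1)
  refine ⟨h3, fun v hv => ?_⟩
  rw [h3, ← div_eq_inv_mul, le_div_iff₀ hr, mul_comm]
  exact h2 v hv

end IsCConvexDomain

/-! ### Extremal bases in terms of the seminorm -/

/-- A preconnected set meeting a set and its complement meets the frontier. -/
theorem IsPreconnected.inter_frontier_nonempty {X : Type*} [TopologicalSpace X] {s t : Set X}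
    (ht : IsPreconnected t) (h1 : (t ∩ s).Nonempty) (h2 : (t ∩ sᶜ).Nonempty) :
    (t ∩ frontier s).Nonempty := by
  by_contra hne
  have hin : ∀ x ∈ t, x ∈ closure s → x ∈ interior s := fun x hx hc => by
    by_contra hi
    exact hne ⟨x, hx, hc, hi⟩
  obtain ⟨x, hx, hxs⟩ := h1
  obtain ⟨y, hy, hys⟩ := h2
  obtain ⟨w, -, hw1, hw2⟩ := ht (interior s) (closure s)ᶜ isOpen_interior
    isClosed_closure.isOpen_compl (fun w hw => or_iff_not_imp_right.2 fun h =>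
      hin w hw (not_not.1 h)) ⟨x, hx, hin x hx (subset_closure hxs)⟩
    ⟨y, hy, fun h => hys (interior_subset (hin y hy h))⟩
  exact hw2 (subset_closure (interior_subset hw1))

theorem relFrontier_disjoint {n : ℕ} {H D : Set (CSpace n)} (hD : IsOpen D) {x : CSpace n}
    (hx : x ∈ relFrontier H D) : x ∉ D := by
  obtain ⟨y, hy, rfl⟩ := hx
  rw [(hD.preimage continuous_subtype_val).frontier_eq] at hy
  exact hy.2

/-- An empty frontier causes no trouble: `Metric.infDist` is then `0` and the hypothesis is void. -/
theorem mem_of_norm_lt_infDist_frontier {n : ℕ} {D : Set (CSpace n)} {q v : CSpace n} (hq : q ∈ D)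
    (hv : ‖v‖ < Metric.infDist q (frontier D)) : q + v ∈ D := by
  by_contra hout
  obtain ⟨x, hx, hxf⟩ := (Metric.isPreconnected_ball (x := q)
    (r := Metric.infDist q (frontier D))).inter_frontier_nonempty (s := D)
    ⟨q, Metric.mem_ball_self ((norm_nonneg v).trans_lt hv), hq⟩
    ⟨q + v, by simpa [mem_ball_iff_norm] using hv, hout⟩
  exact (Metric.infDist_le_dist_of_mem hxf).not_gt (by rwa [dist_comm])

theorem mem_of_norm_lt_infDist_relFrontier {n : ℕ} {D : Set (CSpace n)} {q v : CSpace n}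
    {b : Fin n → CSpace n} {j : Fin n} (hq : q ∈ D) (hvj : v ∈ orthBefore b j)
    (hv : ‖v‖ < Metric.infDist q (relFrontier (planeBefore q b j) D)) : q + v ∈ D := by
  by_contra hout
  have hH : ∀ t : ℝ, q + (t : ℂ) • v ∈ planeBefore q b j := fun t => by
    change q + (t : ℂ) • v - q ∈ orthBefore b j
    rw [add_sub_cancel_left]
    exact Submodule.smul_mem _ _ hvj
  let f : ℝ → planeBefore q b j := fun t => ⟨q + (t : ℂ) • v, hH t⟩
  have hf : Continuous f := Continuous.subtype_mk (by fun_prop) _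
  obtain ⟨_, ⟨t, ht, rfl⟩, hxf⟩ := (isPreconnected_Icc.image f
    (hf.continuousOn (s := Set.Icc 0 1))).inter_frontier_nonempty
    (s := (Subtype.val : planeBefore q b j → CSpace n) ⁻¹' D)
    ⟨f 0, ⟨0, by simp, rfl⟩, by simpa [f] using hq⟩ ⟨f 1, ⟨1, by simp, rfl⟩, by simpa [f] using hout⟩
  have h1 := Metric.infDist_le_dist_of_mem (x := q) (Set.mem_image_of_mem Subtype.val hxf)
  refine h1.not_gt (lt_of_le_of_lt ?_ hv)
  simp only [f, dist_self_add_right, norm_smul, Complex.norm_real, Real.norm_of_nonneg ht.1]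
  exact mul_le_of_le_one_left (norm_nonneg _) ht.2

/-- The ball of radius `s j` in the slicing plane lies in `D` and touches its complement at `e j`,
so `e j` maximizes the seminorm there. -/
theorem IsMinimalBasis.discSeminorm {n : ℕ} {D : Set (CSpace n)} (hD : IsCConvexDomain D)
    {q : CSpace n} (hq : q ∈ D) {e : OrthonormalBasis (Fin n) ℂ (CSpace n)} {s : Fin n → ℝ}
    (h : IsMinimalBasis D q e s) (j : Fin n) :
    0 < s j ∧ hD.discSeminorm hq (e j) = (s j)⁻¹ ∧
      ∀ v ∈ orthBefore e j, hD.discSeminorm hq v ≤ hD.discSeminorm hq (e j) * ‖v‖ := by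
  have hout := relFrontier_disjoint hD.isOpen (h.boundary_point j)
  have hs : 0 < s j := (h.nearest j ▸ Metric.infDist_nonneg : 0 ≤ s j).lt_of_ne fun h0 =>
    hout (by simpa [← h0] using hq)
  exact ⟨hs, hD.discSeminorm_of_sphere hq hs (e.mem_orthBefore_of_le le_rfl) (e.orthonormal.1 j)
    (fun v hvj hv => mem_of_norm_lt_infDist_relFrontier hq hvj (by rwa [← h.nearest j])) hout⟩

namespace IsMaximalBasis

variable {n : ℕ} {D : Set (CSpace n)} {q : CSpace n} {a : OrthonormalBasis (Fin n) ℂ (CSpace n)}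
  {m : Fin n → ℝ}

theorem discSeminorm_first (h : IsMaximalBasis D q a m) (hD : IsCConvexDomain D) (hq : q ∈ D)
    {j : Fin n} (hj : (j : ℕ) = 0) :
    0 < m j ∧ hD.discSeminorm hq (a j) = (m j)⁻¹ ∧
      ∀ v, hD.discSeminorm hq v ≤ hD.discSeminorm hq (a j) * ‖v‖ := by
  have hout : q + (m j : ℂ) • a j ∉ D := by
    have := h.boundary_point j
    rw [hD.isOpen.frontier_eq] at this
    exact this.2
  have hm : 0 < m j := (h.first j hj ▸ Metric.infDist_nonneg : 0 ≤ m j).lt_of_ne fun h0 =>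
    hout (by simpa [← h0] using hq)
  obtain ⟨h1, h2⟩ := hD.discSeminorm_of_sphere hq (H := ⊤) hm Submodule.mem_top
    (a.orthonormal.1 j)
    (fun v _ hv => mem_of_norm_lt_infDist_frontier hq (by rwa [← h.first j hj])) hout
  exact ⟨hm, h1, fun v => h2 v Submodule.mem_top⟩

/-- Maximizing the directional distance means minimizing its reciprocal; homogeneity extends this
from unit vectors. -/
theorem discSeminorm_later (h : IsMaximalBasis D q a m) (hD : IsCConvexDomain D)
    (hline : ContainsNoComplexLine D) (hq : q ∈ D) {j : Fin n} (hj : (j : ℕ) ≠ 0) :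
    0 < m j ∧ hD.discSeminorm hq (a j) = (m j)⁻¹ ∧
      ∀ v ∈ orthBefore a j, hD.discSeminorm hq (a j) * ‖v‖ ≤ hD.discSeminorm hq v := by
  have ha0 : a j ≠ 0 := a.orthonormal.ne_zero j
  have hN := hD.discSeminorm_pos hq hline ha0
  have hatt := h.attained j hj
  rw [hD.dirDist_eq hq hline ha0] at hatt
  have hm : 0 < m j := ENNReal.ofReal_pos.1 (hatt ▸ ENNReal.ofReal_pos.2 (inv_pos.2 hN))
  have hmN : m j = (hD.discSeminorm hq (a j))⁻¹ :=
    (ENNReal.ofReal_eq_ofReal_iff hm.le (inv_pos.2 hN).le).1 hatt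
  refine ⟨hm, by rw [hmN, inv_inv], fun v hv => ?_⟩
  rcases eq_or_ne v 0 with rfl | hv0
  · simp
  have hv' := norm_pos_iff.2 hv0
  set w : CSpace n := ((‖v‖⁻¹ : ℝ) : ℂ) • v with hw
  have hw1 : ‖w‖ = 1 := by
    rw [hw, norm_smul, Complex.norm_real, norm_inv, norm_norm, inv_mul_cancel₀ hv'.ne']
  have hw0 : w ≠ 0 := norm_ne_zero_iff.1 (by rw [hw1]; exact one_ne_zero)
  have hle : dirDist D q w ≤ ENNReal.ofReal (m j) := by
    rw [h.maximal j hj]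
    exact le_iSup₂_of_le w ⟨Submodule.smul_mem _ _ hv, hw1⟩ le_rfl
  have hNw := hD.discSeminorm_pos hq hline hw0
  rw [hD.dirDist_eq hq hline hw0, hmN, ENNReal.ofReal_le_ofReal_iff (inv_pos.2 hN).le,
    inv_le_inv₀ hNw hN, hw, map_smul_eq_mul, Complex.norm_real, norm_inv, norm_norm,
    ← div_eq_inv_mul, le_div_iff₀ hv'] at hle
  exact hle

end IsMaximalBasis

/-! ### The comparison of the two bases -/

theorem proposition1 (n : ℕ) :
    ∃ C : ℝ, 0 < C ∧
      ∀ D : Set (CSpace n), IsCConvexDomain D → ContainsNoComplexLine D →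
        ∀ z ∈ D,
          ∀ (a : OrthonormalBasis (Fin n) ℂ (CSpace n)) (m : Fin n → ℝ), IsMaximalBasis D z a m →
            ∀ (e : OrthonormalBasis (Fin n) ℂ (CSpace n)) (s : Fin n → ℝ),
              IsMinimalBasis D z e s →
                ∀ j : Fin n, m (reorder j) ≤ C * s j ∧ s j ≤ C * m (reorder j) := by
  refine ⟨(n : ℝ) ^ 2 * 2 ^ n + 3, by positivity, ?_⟩
  intro D hD hline z hz a m hm e s hs j
  have hmin := hs.discSeminorm hD hz
  have hmax : ∀ k, 0 < m k ∧ hD.discSeminorm hz (a k) = (m k)⁻¹ := fun k => by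
    by_cases hk : (k : ℕ) = 0
    · exact ⟨(hm.discSeminorm_first hD hz hk).1, (hm.discSeminorm_first hD hz hk).2.1⟩
    · exact ⟨(hm.discSeminorm_later hD hline hz hk).1, (hm.discSeminorm_later hD hline hz hk).2.1⟩
  obtain ⟨h1, h2⟩ := seminorm_reorder_comparable (hD.discSeminorm hz) a e
    (fun j => (hmin j).2.2) (fun j hj => (hm.discSeminorm_first hD hz hj).2.2)
    (fun j hj => (hm.discSeminorm_later hD hline hz hj).2.2) j
  have hsj := (hmin j).1
  have hmj := (hmax (reorder j)).1
  -- Passing to reciprocals, the factor `3` bounds `s j` and the factor `n² 2ⁿ` bounds `m (reorder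
  -- j)`; `C` is their sum.
  rw [(hmin j).2.1, (hmax (reorder j)).2, ← div_eq_mul_inv, inv_eq_one_div,
    div_le_div_iff₀ (by assumption) (by assumption)] at h1 h2
  have hC : (0 : ℝ) ≤ n ^ 2 * 2 ^ n := by positivity
  constructor
  · nlinarith
  · nlinarith [mul_nonneg hC hmj.le]
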